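/- Let $F$ be a non-discrete locally compact non-Archimedean field with absolute value $|\cdot|$, let $\mathcal O_F=\{x\in F: |x|\le 1\}$ be its ring of integers, and let $\varpi$ be a generator of the maximal ideal $\{x\in F:|x|<1\}$. Let $\mathrm{Mat}(\mathbb N,F)$ be the space of all matrices $(M_{ij})_{i,j\in\mathbb N}$ over $F$, with the product topology, and let $\mathrm{GL}(\infty,\mathcal O_F)=\varinjlim \mathrm{GL}(n,\mathcal O_F)$ be the group of invertible infinite matrices $g$ over $\mathcal O_F$ with $g_{ij}=\delta_{ij}$ for $i+j$ large enough. The group $\mathrm{GL}(\infty,\mathcal O_F)\times \mathrm{GL}(\infty,\mathcal O_F)$ acts on $\mathrm{Mat}(\mathbb N,F)$ by $(g_1,g_2)\cdot M=g_1Mg_2^{-1}$. Let $\Delta$ be the set of non-increasing sequences $\mathbb k=(k_n)_{n\ge 1}$ in $\mathbb Z\cup\{-\infty\}$. Let $X_i^{(n)},Y_i^{(n)},Z_{ij}$ $(i,j,n\ge 1)$ be independent random variables, each distributed according to the normalized Haar measure of the compact additive group $\mathcal O_F$. For $\mathbb k\in\Delta$ put $k=\lim_n k_n\in\mathbb Z\cup\{-\infty\}$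 and, with the convention $\varpi^{\infty}=0$, let $\mu_{\mathbb k}$ be the law of the random matrix $$M_{\mathbb k}=\Big[\sum_{n:\,k_n>k}\varpi^{-k_n}X_i^{(n)}Y_j^{(n)}+\varpi^{-k}Z_{ij}\Big]_{i,j\in\mathbb N}.$$ Theorem. For every $\mathbb k\in\Delta$, the measure $\mu_{\mathbb k}$ is a $\mathrm{GL}(\infty,\mathcal O_F)\times\mathrm{GL}(\infty,\mathcal O_F)$-invariant Borel probability measure on $\mathrm{Mat}(\mathbb N,F)$, and it is ergodic: for every Borel set $\mathcal A\subset\mathrm{Mat}(\mathbb N,F)$ that is invariant under this group, $\mu_{\mathbb k}(\mathcal A)=0$ or $\mu_{\mathbb k}(\mathrm{Mat}(\mathbb N,F)\setminus\mathcal A)=0$. -/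

import Mathlib

open MeasureTheory Filter

noncomputable section

namespace InfMat

section Field

variable (F : Type*) [NontriviallyNormedField F] [IsUltrametricDist F]

/-- The ring of integers `{x : F | ‖x‖ ≤ 1}` of a non-Archimedean normed field. -/
abbrev Integers : Subring F := (NormedField.valuation (K := F)).integer

variable {F}

theorem mem_Integers {x : F} : x ∈ Integers F ↔ ‖x‖ ≤ 1 := by
  rw [Valuation.mem_integer_iff, NormedField.valuation_apply, ← NNReal.coe_le_coe]
  simp

instance instCompactSpaceIntegers [LocallyCompactSpace F] : CompactSpace (Integers F) := by
  have : ProperSpace F := .of_nontriviallyNormedField_of_weaklyLocallyCompactSpace F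
  have h : ((Integers F : Subring F) : Set F) = Metric.closedBall 0 1 := by
    ext x
    simp [mem_Integers]
  refine isCompact_iff_compactSpace.mp ?_
  rw [h]
  exact isCompact_closedBall 0 1

/-- `ϖ` generates the maximal ideal `{x | ‖x‖ < 1}` of the ring of integers. -/
def IsUniformizer (ϖ : F) : Prop :=
  {x : F | ‖x‖ < 1} = {x : F | ∃ y ∈ Integers F, x = ϖ * y}

variable (F)

/-- The normalized Haar measure on the compact additive group of the ring of integers. -/
def haarIntegers [LocallyCompactSpace F] [MeasurableSpace F] [BorelSpace F] :
    Measure (Integers F) :=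
  Measure.addHaarMeasure ⊤

instance instIsProbabilityMeasureHaarIntegers [LocallyCompactSpace F] [MeasurableSpace F]
    [BorelSpace F] : IsProbabilityMeasure (haarIntegers F) :=
  ⟨by simpa [haarIntegers] using
    Measure.addHaarMeasure_self (K₀ := (⊤ : TopologicalSpace.PositiveCompacts (Integers F)))⟩

end Field

section Group

variable (R : Type*) [Ring R]

/-- The `(i, j)` entry of an automorphism of `R^(ℕ)` in the standard basis. -/
def entry {R : Type*} [Ring R] (g : (ℕ →₀ R) ≃ₗ[R] (ℕ →₀ R)) (i j : ℕ) : R :=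
  g (Finsupp.single j 1) i

theorem apply_eq_of_le {R : Type*} [Ring R] {g : (ℕ →₀ R) ≃ₗ[R] (ℕ →₀ R)} {N : ℕ}
    (hg : ∀ i j, N ≤ i + j → entry g i j = if i = j then 1 else 0) {i : ℕ} (hi : N ≤ i)
    (v : ℕ →₀ R) : g v i = v i := by
  induction v using Finsupp.induction_linear with
  | zero => simp
  | add v w hv hw => simp [hv, hw]
  | single j a =>
    have h : Finsupp.single j a = a • Finsupp.single j (1 : R) := by simp
    have := hg i j (by omega)
    unfold entry at this
    rw [h, map_smul, Finsupp.smul_apply, this, Finsupp.smul_apply, Finsupp.single_apply]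
    simp [eq_comm]

theorem apply_single_of_le {R : Type*} [Ring R] {g : (ℕ →₀ R) ≃ₗ[R] (ℕ →₀ R)} {N : ℕ}
    (hg : ∀ i j, N ≤ i + j → entry g i j = if i = j then 1 else 0) {j : ℕ} (hj : N ≤ j) :
    g (Finsupp.single j 1) = Finsupp.single j 1 := by
  ext i
  have := hg i j (by omega)
  unfold entry at this
  rw [this, Finsupp.single_apply]
  simp [eq_comm]

/-- The group `GL(∞, R)`, the union of the groups `GL(n, R)` embedded in each other as upper left
corners: invertible infinite matrices `g` over `R` (automorphisms of `R^(ℕ)` written in the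
standard basis) such that `g i j = δ i j` whenever `i + j` is large enough. -/
def GLInf : Subgroup ((ℕ →₀ R) ≃ₗ[R] (ℕ →₀ R)) where
  carrier := {g | ∃ N : ℕ, ∀ i j, N ≤ i + j → entry g i j = if i = j then 1 else 0}
  one_mem' := ⟨0, fun i j _ => by simp [entry, Finsupp.single_apply, eq_comm]⟩
  mul_mem' := by
    rintro g h ⟨N, hN⟩ ⟨M, hM⟩
    refine ⟨2 * (N + M), fun i j hij => ?_⟩
    have hδ : (Finsupp.single j (1 : R)) i = if i = j then 1 else 0 := by
      simp [Finsupp.single_apply, eq_comm]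
    change g (h (Finsupp.single j 1)) i = _
    rcases le_or_gt (N + M) i with hi | hi
    · rw [apply_eq_of_le hN (by omega), apply_eq_of_le hM (by omega), hδ]
    · rw [apply_single_of_le hM (by omega), apply_single_of_le hN (by omega), hδ]
  inv_mem' := by
    rintro g ⟨N, hN⟩
    refine ⟨2 * N, fun i j hij => ?_⟩
    have hδ : (Finsupp.single j (1 : R)) i = if i = j then 1 else 0 := by
      simp [Finsupp.single_apply, eq_comm]
    change g.symm (Finsupp.single j 1) i = _
    rcases le_or_gt N i with hi | hi
    · rw [← apply_eq_of_le hN hi, LinearEquiv.apply_symm_apply, hδ]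
    · have hj : N ≤ j := by omega
      rw [← hδ]
      congr 1
      rw [LinearEquiv.symm_apply_eq, apply_single_of_le hN hj]

end Group

section Action

variable {F : Type*} [NontriviallyNormedField F] [IsUltrametricDist F]

/-- The space `Mat(ℕ, F)` of all infinite matrices, with the product topology and the product
`σ`-algebra (which is the Borel `σ`-algebra when `F` is second countable). -/
abbrev MatN (F : Type*) := ℕ → ℕ → F

/-- The product of infinite matrices, meaningful when all the sums are finite, as they are if the
rows of `A` or the columns of `B` are finitely supported. -/
def mulMat {F : Type*} [Field F] (A B : MatN F) : MatN F := fun i j => ∑ᶠ l, A i l * B l j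

/-- An element of `GL(∞, O_F)` as an infinite matrix over `F`. -/
def toMat (g : GLInf (Integers F)) : MatN F :=
  fun i j => ((entry g.1 i j : Integers F) : F)

theorem mulMat_eq {F : Type*} [Field F] {A B : MatN F} {i j K : ℕ} (h : ∀ l, K ≤ l → A i l * B l j = 0) :
    mulMat A B i j = ∑ l ∈ Finset.range K, A i l * B l j := by
  refine finsum_eq_sum_of_support_subset _ fun l hl => ?_
  by_contra hl'
  exact hl (h l (by simpa using hl'))

theorem mulMat_assoc_of_row {F : Type*} [Field F] {A B C : MatN F} {i j K : ℕ} (h₁ : ∀ l, K ≤ l → A i l = 0)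
    (h₂ : ∀ l, l < K → ∀ m, K ≤ m → B l m * C m j = 0) :
    mulMat (mulMat A B) C i j = mulMat A (mulMat B C) i j := by
  have hAB : ∀ m, mulMat A B i m = ∑ l ∈ Finset.range K, A i l * B l m := fun m =>
    mulMat_eq fun l hl => by simp [h₁ l hl]
  rw [mulMat_eq (K := K) (A := mulMat A B), mulMat_eq (K := K) (A := A)]
  · simp_rw [hAB, Finset.sum_mul]
    rw [Finset.sum_comm]
    refine Finset.sum_congr rfl fun l hl => ?_
    rw [mulMat_eq (h₂ l (Finset.mem_range.mp hl)), Finset.mul_sum]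
    simp [mul_assoc]
  · intro l hl
    simp [h₁ l hl]
  · intro m hm
    rw [hAB, Finset.sum_mul]
    refine Finset.sum_eq_zero fun l hl => ?_
    rw [mul_assoc, h₂ l (Finset.mem_range.mp hl) m hm, mul_zero]

theorem mulMat_assoc_of_col {F : Type*} [Field F] {A B C : MatN F} {i j K : ℕ} (h₁ : ∀ m, K ≤ m → C m j = 0)
    (h₂ : ∀ m, m < K → ∀ l, K ≤ l → A i l * B l m = 0) :
    mulMat (mulMat A B) C i j = mulMat A (mulMat B C) i j := by
  have hBC : ∀ l, mulMat B C l j = ∑ m ∈ Finset.range K, B l m * C m j := fun l =>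
    mulMat_eq fun m hm => by simp [h₁ m hm]
  rw [mulMat_eq (K := K) (A := mulMat A B), mulMat_eq (K := K) (A := A)]
  · simp_rw [hBC, Finset.mul_sum]
    rw [Finset.sum_comm]
    refine Finset.sum_congr rfl fun m hm => ?_
    rw [mulMat_eq (h₂ m (Finset.mem_range.mp hm)), Finset.sum_mul]
    simp [mul_assoc]
  · intro l hl
    rw [hBC, Finset.mul_sum]
    refine Finset.sum_eq_zero fun m hm => ?_
    rw [← mul_assoc, h₂ m (Finset.mem_range.mp hm) l hl, zero_mul]
  · intro m hm
    simp [h₁ m hm]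

theorem exists_toMat_eq (g : GLInf (Integers F)) :
    ∃ N, ∀ i j, N ≤ i ∨ N ≤ j → toMat g i j = if i = j then 1 else 0 := by
  obtain ⟨N, hN⟩ := g.2
  refine ⟨N, fun i j hij => ?_⟩
  unfold toMat
  rw [hN i j (by omega)]
  split_ifs <;> simp

theorem toMat_one : toMat (1 : GLInf (Integers F)) = fun i j => if i = j then 1 else 0 := by
  funext i j
  simp only [toMat, entry, OneMemClass.coe_one, LinearEquiv.coe_one, id_eq, Finsupp.single_apply]
  simp only [eq_comm (a := j)]
  split_ifs <;> simp

theorem toMat_mul (g h : GLInf (Integers F)) :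
    toMat (g * h) = mulMat (toMat g) (toMat h) := by
  funext i j
  obtain ⟨N, hN⟩ := exists_toMat_eq g
  have key : ∀ v : ℕ →₀ Integers F,
      ((g.1 v i : Integers F) : F) =
        ∑ l ∈ Finset.range (N + i + 1), toMat g i l * ((v l : Integers F) : F) := by
    intro v
    induction v using Finsupp.induction_linear with
    | zero => simp
    | add v w hv hw => simp [hv, hw, mul_add, Finset.sum_add_distrib]
    | single l a =>
      have hs : Finsupp.single l a = a • Finsupp.single l (1 : Integers F) := by simp
      have hl : ((g.1 (Finsupp.single l a) i : Integers F) : F) = toMat g i l * a := by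
        rw [hs, map_smul, Finsupp.smul_apply]
        simp [toMat, entry, mul_comm]
      rw [hl]
      by_cases hlK : l < N + i + 1
      · rw [Finset.sum_eq_single l]
        · simp
        · intro b _ hb
          simp [Ne.symm hb]
        · intro h
          exact absurd (Finset.mem_range.mpr hlK) h
      · rw [hN i l (by omega), if_neg (by omega), zero_mul]
        refine (Finset.sum_eq_zero fun b hb => ?_).symm
        have : l ≠ b := by
          have := Finset.mem_range.mp hb
          omega
        simp [this]
  rw [mulMat_eq (K := N + i + 1)]
  · exact key _
  · intro l hl
    rw [hN i l (by omega), if_neg (by omega), zero_mul]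

theorem toMat_row (g : GLInf (Integers F)) :
    ∃ N, ∀ i l, N ≤ l → i < l → toMat g i l = 0 ∧ toMat g l i = 0 := by
  obtain ⟨N, hN⟩ := exists_toMat_eq g
  exact ⟨N, fun i l h₁ h₂ => ⟨by rw [hN i l (by omega), if_neg (by omega)],
    by rw [hN l i (by omega), if_neg (by omega)]⟩⟩

/-- The action of `GL(∞, O_F) × GL(∞, O_F)` on `Mat(ℕ, F)`, `(g₁, g₂) • M = g₁ M g₂⁻¹`. -/
instance instMulActionMatN :
    MulAction (GLInf (Integers F) × GLInf (Integers F)) (MatN F) where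
  smul g M := mulMat (mulMat (toMat g.1) M) (toMat g.2⁻¹)
  one_smul M := by
    change mulMat (mulMat (toMat 1) M) (toMat 1⁻¹) = M
    funext i j
    rw [inv_one, toMat_one, mulMat_eq (K := j + 1), Finset.sum_eq_single j,
      mulMat_eq (K := i + 1), Finset.sum_eq_single i] <;> grind
  mul_smul g h M := by
    change mulMat (mulMat (toMat (g.1 * h.1)) M) (toMat (g.2 * h.2)⁻¹) =
      mulMat (mulMat (toMat g.1) (mulMat (mulMat (toMat h.1) M) (toMat h.2⁻¹))) (toMat g.2⁻¹)
    have hl : ∀ (a b : GLInf (Integers F)) (A : MatN F),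
        mulMat (toMat (a * b)) A = mulMat (toMat a) (mulMat (toMat b) A) := by
      intro a b A
      obtain ⟨N₁, h₁⟩ := toMat_row a
      obtain ⟨N₂, h₂⟩ := toMat_row b
      rw [toMat_mul]
      funext i j
      refine mulMat_assoc_of_row (K := N₁ + N₂ + i + 1) (fun l hl => ?_) fun l hl m hm => ?_
      · exact (h₁ i l (by omega) (by omega)).1
      · rw [(h₂ l m (by omega) (by omega)).1, zero_mul]
    have hr : ∀ (a b : GLInf (Integers F)) (A : MatN F),
        mulMat A (toMat (a * b)) = mulMat (mulMat A (toMat a)) (toMat b) := by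
      intro a b A
      obtain ⟨N₁, h₁⟩ := toMat_row a
      obtain ⟨N₂, h₂⟩ := toMat_row b
      rw [toMat_mul]
      funext i j
      refine (mulMat_assoc_of_col (K := N₁ + N₂ + j + 1) (fun l hl => ?_) fun m hm l hl => ?_).symm
      · exact (h₂ j l (by omega) (by omega)).2
      · rw [(h₁ m l (by omega) (by omega)).2, mul_zero]
    have hm : ∀ (a b : GLInf (Integers F)) (A : MatN F),
        mulMat (mulMat (toMat a) A) (toMat b) = mulMat (toMat a) (mulMat A (toMat b)) := by
      intro a b A
      obtain ⟨N₁, h₁⟩ := toMat_row a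
      obtain ⟨N₂, h₂⟩ := toMat_row b
      funext i j
      refine mulMat_assoc_of_row (K := N₁ + N₂ + i + j + 1) (fun l hl => ?_) fun l hl m hm => ?_
      · exact (h₁ i l (by omega) (by omega)).1
      · rw [(h₂ j m (by omega) (by omega)).2, mul_zero]
    rw [mul_inv_rev, hl, hr, hm g.1 h.2⁻¹]

end Action

section Ergodic

/-- `μ` is an ergodic `G`-invariant probability measure: every measurable set which is
`G`-invariant (in the strict sense) is null or has a null complement. -/
structure IsErgodicInvariant (G : Type*) {X : Type*} [Group G] [MulAction G X]
    [MeasurableSpace X] (μ : Measure X) : Prop where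
  isProbabilityMeasure : IsProbabilityMeasure μ
  invariant : SMulInvariantMeasure G X μ
  ergodic : ∀ A : Set X, MeasurableSet A → (∀ g : G, (fun x => g • x) ⁻¹' A = A) →
    μ A = 0 ∨ μ Aᶜ = 0

end Ergodic

section Parameters

/-- The set `Δ` of non-increasing sequences in `ℤ ∪ {-∞}`. -/
abbrev Delta := {k : ℕ → WithBot ℤ // Antitone k}

/-- The limit in `ℤ ∪ {-∞}` of a non-increasing sequence, that is, its infimum. -/
def Delta.lim (k : Delta) : WithBot ℤ := ⨅ n, k.1 n

theorem Delta.isGLB_lim (k : Delta) : IsGLB (Set.range k.1) k.lim :=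
  isGLB_ciInf (OrderBot.bddBelow _)

/-- `ϖ ^ (-k)` for `k ∈ ℤ ∪ {-∞}`, with the convention `ϖ ^ ∞ = 0`. -/
def negPow {F : Type*} [Field F] (ϖ : F) (k : WithBot ℤ) : F :=
  WithBot.recBotCoe 0 (fun m : ℤ => ϖ ^ (-m)) k

end Parameters

section Measures

variable {F : Type*} [NontriviallyNormedField F] [IsUltrametricDist F]

/-- Labels of the random variables. -/
inductive Label : Type
  /-- the label of `X_i^{(n)}` -/
  | X (n i : ℕ)
  /-- the label of `Y_i^{(n)}` -/
  | Y (n i : ℕ)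
  /-- the label of `Z_{ij}` -/
  | Z (i j : ℕ)

/-- The random matrix `M_k` with entries
`∑_{n : k_n > k} ϖ^{-k_n} X_i^{(n)} Y_j^{(n)} + ϖ^{-k} Z_{ij}`, where `k = lim k_n`, as a function
of the values `ω` of the random variables `X_i^{(n)}`, `Y_i^{(n)}`, `Z_{ij}`. -/
def randomMatrix (ϖ : F) (k : Delta) (ω : Label → Integers F) : MatN F := fun i j =>
  (∑' n : {n : ℕ // k.lim < k.1 n},
    negPow ϖ (k.1 n) * (ω (.X n i) : F) * (ω (.Y n j) : F)) + negPow ϖ k.lim * (ω (.Z i j) : F)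

/-- The series defining the entries of `M_k` converge, for all values of the variables. -/
theorem summable_randomMatrix [LocallyCompactSpace F] {ϖ : F} (hϖ : IsUniformizer ϖ) (k : Delta)
    (ω : Label → Integers F) (i j : ℕ) :
    Summable fun n : {n : ℕ // k.lim < k.1 n} =>
      negPow ϖ (k.1 n) * (ω (.X n i) : F) * (ω (.Y n j) : F) := by
  have : ProperSpace F := .of_nontriviallyNormedField_of_weaklyLocallyCompactSpace F
  have hϖ1 : ‖ϖ‖ < 1 := by
    have h : ϖ ∈ {x : F | ∃ y ∈ Integers F, x = ϖ * y} := ⟨1, one_mem _, by simp⟩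
    rwa [← hϖ] at h
  have hfin : ∀ b : WithBot ℤ, k.lim < b → {n : {n : ℕ // k.lim < k.1 n} | b ≤ k.1 n}.Finite := by
    intro b hb
    obtain ⟨n₀, hn₀⟩ : ∃ n₀, k.1 n₀ < b := by
      by_contra! h
      exact absurd (k.isGLB_lim.2 (by rintro _ ⟨n, rfl⟩; exact h n)) (not_le.mpr hb)
    refine ((Set.finite_lt_nat n₀).preimage Subtype.val_injective.injOn).subset fun n hn => ?_
    by_contra h
    exact absurd ((k.2 (not_lt.mp h)).trans_lt hn₀) (not_lt.mpr hn)
  have hint : ∀ x : Integers F, ‖(x : F)‖ ≤ 1 := fun x => mem_Integers.mp x.2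
  induction hl : k.lim using WithBot.recBotCoe with
  | coe m =>
    have hf := hfin ((m + 1 : ℤ) : WithBot ℤ) (by rw [hl]; exact_mod_cast lt_add_one m)
    have key : ∀ b : WithBot ℤ, (m : WithBot ℤ) < b → ((m + 1 : ℤ) : WithBot ℤ) ≤ b := by
      intro b hb
      induction b using WithBot.recBotCoe with
      | bot => exact absurd hb not_lt_bot
      | coe a => exact WithBot.coe_le_coe.mpr (WithBot.coe_lt_coe.mp hb)
    have : Finite {n : ℕ // k.lim < k.1 n} := by
      rw [← Set.finite_univ_iff]
      refine hf.subset fun n _ => ?_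
      exact key _ (lt_of_eq_of_lt hl.symm n.2)
    rw [← hl]
    exact Summable.of_finite
  | bot =>
    rw [← hl]
    refine NonarchimedeanAddGroup.summable_of_tendsto_cofinite_zero ?_
    rw [Metric.tendsto_nhds]
    intro ε hε
    obtain ⟨s, hs⟩ := exists_pow_lt_of_lt_one hε hϖ1
    rw [Filter.eventually_cofinite]
    refine (hfin ((-s : ℤ) : WithBot ℤ) (by rw [hl]; exact WithBot.bot_lt_coe _)).subset ?_
    intro n hn
    by_contra hlt
    refine hn ?_
    rw [dist_zero_right]
    change ¬ _ ≤ k.1 n at hlt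
    have h1 : ‖negPow ϖ (k.1 n)‖ < ε := by
      induction h : k.1 n using WithBot.recBotCoe with
      | bot => simpa [negPow] using hε
      | coe a =>
        rw [h, WithBot.coe_le_coe, not_le] at hlt
        obtain ⟨t, ht⟩ : ∃ t : ℕ, -a = (t : ℤ) := ⟨(-a).toNat, by omega⟩
        have : s ≤ t := by omega
        simp only [negPow, WithBot.recBotCoe_coe, ht, zpow_natCast, norm_pow]
        exact (pow_le_pow_of_le_one (norm_nonneg _) hϖ1.le this).trans_lt hs
    calc _ ≤ ‖negPow ϖ (k.1 n)‖ * 1 * 1 := by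
          rw [norm_mul, norm_mul]
          gcongr <;> exact hint _
      _ < ε := by simpa using h1

/-- The law `μ_k` of `M_k` when all the `X_i^{(n)}`, `Y_i^{(n)}`, `Z_{ij}` are independent and
distributed according to the normalized Haar measure of the ring of integers. -/
def mu [LocallyCompactSpace F] [MeasurableSpace F] [BorelSpace F] (ϖ : F) (k : Delta) :
    Measure (MatN F) :=
  (Measure.infinitePi fun _ : Label => haarIntegers F).map (randomMatrix ϖ k)

end Measures

end InfMat

end

/-! Invariance. The variables form a point of a countable power of the compact group `Integers F`,
distributed by Haar measure. Since g₁(x yᵀ)g₂⁻¹ = (g₁x)(g₂⁻ᵀy)ᵀ, acting on the random matrix amounts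
to acting on the variables (`smul_randomMatrix`). That action is a continuous additive automorphism,
and Haar probability measure is preserved by such maps.

Ergodicity, as in the Hewitt–Savage zero-one law. Permuting rows and columns simultaneously moves
the corner [0, N)² onto the diagonal block [N, 2N)². These two blocks involve disjoint sets of
variables, hence are independent (`mu_inter_blockSwap`). Rows and columns must both move, since
blocks sharing row indices share variables X, and blocks sharing column indices share variables Y.
An invariant set A is approximated by corner events B, and μ(B ∩ τ⁻¹B) = μ(B)² passes to the limit
as μ(A) = μ(A)² (`measure_eq_zero_or_compl_of_decoupling`). -/

noncomputable section

namespace InfMat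

/-! ### An abstract zero-one law. -/

section ZeroOne

open scoped symmDiff
open Set

/-- A probability measure is trivial on a set invariant under maps `τ N` which asymptotically
decouple the sets of an exhausting filtration `m` from themselves. -/
theorem measure_eq_zero_or_compl_of_decoupling {X : Type*} [mX : MeasurableSpace X]
    {μ : Measure X} [IsProbabilityMeasure μ] {m : ℕ → MeasurableSpace X} (hm : Monotone m)
    (hsup : mX = ⨆ N, m N) {τ : ℕ → X → X} (hτ : ∀ N, MeasurePreserving (τ N) μ μ)
    (hdec : ∀ N B, MeasurableSet[m N] B → μ (B ∩ τ N ⁻¹' B) = μ B * μ B)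
    {A : Set X} (hA : MeasurableSet A) (hinv : ∀ N, τ N ⁻¹' A = A) :
    μ A = 0 ∨ μ Aᶜ = 0 := by
  have hle : ∀ N, m N ≤ mX := fun N => hsup ▸ le_iSup m N
  have hring : IsSetRing {s : Set X | ∃ N, MeasurableSet[m N] s} := by
    refine ⟨⟨0, @MeasurableSet.empty X (m 0)⟩, ?_, ?_⟩
    · rintro s t ⟨N, hs⟩ ⟨M, ht⟩
      exact ⟨max N M, @MeasurableSet.union X (m (max N M)) _ _ (hm (le_max_left N M) s hs)
        (hm (le_max_right N M) t ht)⟩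
    · rintro s t ⟨N, hs⟩ ⟨M, ht⟩
      exact ⟨max N M, @MeasurableSet.diff X (m (max N M)) _ _ (hm (le_max_left N M) s hs)
        (hm (le_max_right N M) t ht)⟩
  have hgen : mX = MeasurableSpace.generateFrom {s : Set X | ∃ N, MeasurableSet[m N] s} := by
    have hU : {s : Set X | ∃ N, MeasurableSet[m N] s} = ⋃ N, {s | MeasurableSet[m N] s} := by
      ext s; simp
    rw [hU]
    exact hsup.trans (MeasurableSpace.generateFrom_iUnion_measurableSet m).symm
  -- With a = μ(A) and b = μ(B), the bounds below are |b² - a| ≤ 2ε and |b² - a²| ≤ 2ε, whence the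
  -- constant 4.
  have key : ∀ ε : ℝ, 0 < ε → |μ.real A - μ.real A * μ.real A| ≤ 4 * ε := by
    intro ε hε
    obtain ⟨B, ⟨N, hB⟩, hBA⟩ := exists_measure_symmDiff_lt_of_generateFrom_isSetRing (μ := μ)
      hring ⟨{univ}, countable_singleton _, by
        rintro _ rfl; exact ⟨0, @MeasurableSet.univ X (m 0)⟩, by simp⟩ hgen hA
      (ENNReal.ofReal_pos.mpr hε)
    have hB' : MeasurableSet B := hle N B hB
    have hτB : MeasurableSet (τ N ⁻¹' B) := (hτ N).measurable hB'
    have h1 : μ.real (B ∆ A) ≤ ε :=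
      ENNReal.toReal_le_of_le_ofReal hε.le hBA.le
    have h2 : μ.real ((τ N ⁻¹' B) ∆ A) ≤ ε := by
      -- Strict invariance of A turns the difference into a preimage, whose measure `τ N` preserves.
      have : (τ N ⁻¹' B) ∆ A = τ N ⁻¹' (B ∆ A) := by
        conv_lhs => rw [← hinv N]
        rfl
      rw [this, (hτ N).measureReal_preimage (hB'.symmDiff hA).nullMeasurableSet]
      exact h1
    have h3 : μ.real ((B ∩ τ N ⁻¹' B) ∆ A) ≤ ε + ε := by
      refine (measureReal_mono (s₂ := (B ∆ A) ∪ ((τ N ⁻¹' B) ∆ A)) ?_).trans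
        ((measureReal_union_le _ _).trans (add_le_add h1 h2))
      intro x hx
      simp only [mem_symmDiff, mem_inter_iff, mem_union] at hx ⊢
      tauto
    have h4 := (abs_measureReal_sub_le_measureReal_symmDiff (μ := μ)
      hB'.nullMeasurableSet hA.nullMeasurableSet).trans h1
    have h5 := (abs_measureReal_sub_le_measureReal_symmDiff (μ := μ)
      (hB'.inter hτB).nullMeasurableSet hA.nullMeasurableSet).trans h3
    have h6 : μ.real (B ∩ τ N ⁻¹' B) = μ.real B * μ.real B := by
      simp [Measure.real, hdec N B hB]
    rw [h6] at h5
    have hA1 : μ.real A ≤ 1 := measureReal_le_one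
    have hB1 : μ.real B ≤ 1 := measureReal_le_one
    have hA0 : 0 ≤ μ.real A := measureReal_nonneg
    have hB0 : 0 ≤ μ.real B := measureReal_nonneg
    have h7 : |μ.real B * μ.real B - μ.real A * μ.real A| ≤ ε * 2 := by
      rw [show μ.real B * μ.real B - μ.real A * μ.real A =
        (μ.real B - μ.real A) * (μ.real B + μ.real A) by ring, abs_mul]
      gcongr
      rw [abs_of_nonneg (by positivity)]
      linarith
    rw [abs_le] at *
    constructor <;> linarith
  have h0 : μ.real A - μ.real A * μ.real A = 0 := by
    by_contra h
    have := abs_pos.mpr h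
    have := key (|μ.real A - μ.real A * μ.real A| / 8) (by positivity)
    linarith
  have h1 : μ.real A * (1 - μ.real A) = 0 := by linarith
  rcases mul_eq_zero.mp h1 with h | h
  · left
    exact (measureReal_eq_zero_iff).mp h
  · right
    rw [← measureReal_eq_zero_iff, probReal_compl_eq_one_sub hA, h]

end ZeroOne

/-! ### Haar measure on products of compact groups. -/

section Haar

/-- A product of left-invariant probability measures is left-invariant. -/
theorem isAddLeftInvariant_infinitePi {ι : Type*} {G : ι → Type*} [∀ i, AddGroup (G i)]
    [∀ i, MeasurableSpace (G i)] [∀ i, MeasurableAdd (G i)] (μ : ∀ i, Measure (G i))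
    [∀ i, IsProbabilityMeasure (μ i)] [∀ i, (μ i).IsAddLeftInvariant] :
    (Measure.infinitePi μ).IsAddLeftInvariant := by
  refine ⟨fun g => ?_⟩
  have := Measure.infinitePi_map_pi (μ := μ) (f := fun i x => g i + x)
    (fun i => measurable_const_add (g i))
  simp only [map_add_left_eq_self] at this
  exact this

/-- A product of Haar probability measures on second countable compact groups is a Haar measure. -/
theorem isAddHaarMeasure_infinitePi {ι : Type*} [Countable ι] {G : ι → Type*}
    [∀ i, AddGroup (G i)] [∀ i, TopologicalSpace (G i)] [∀ i, IsTopologicalAddGroup (G i)]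
    [∀ i, CompactSpace (G i)] [∀ i, SecondCountableTopology (G i)]
    [∀ i, MeasurableSpace (G i)] [∀ i, BorelSpace (G i)] (μ : ∀ i, Measure (G i))
    [∀ i, IsProbabilityMeasure (μ i)] [∀ i, (μ i).IsAddLeftInvariant] :
    (Measure.infinitePi μ).IsAddHaarMeasure := by
  have := isAddLeftInvariant_infinitePi μ
  exact Measure.isAddHaarMeasure_of_isCompact_nonempty_interior _ Set.univ isCompact_univ
    (by simp) (by simp) (by simp)

/-- A continuous automorphism of a product of second countable compact groups preserves the product
of the Haar probability measures. -/
theorem measurePreserving_infinitePi {ι : Type*} [Countable ι] {G : ι → Type*}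
    [∀ i, AddCommGroup (G i)] [∀ i, TopologicalSpace (G i)] [∀ i, IsTopologicalAddGroup (G i)]
    [∀ i, CompactSpace (G i)] [∀ i, SecondCountableTopology (G i)]
    [∀ i, MeasurableSpace (G i)] [∀ i, BorelSpace (G i)] (μ : ∀ i, Measure (G i))
    [∀ i, IsProbabilityMeasure (μ i)] [∀ i, (μ i).IsAddLeftInvariant]
    (T : (∀ i, G i) → ∀ i, G i) (hadd : ∀ x y, T (x + y) = T x + T y) (hcont : Continuous T)
    (hsurj : Function.Surjective T) :
    MeasurePreserving T (Measure.infinitePi μ) (Measure.infinitePi μ) := by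
  have := isAddHaarMeasure_infinitePi μ
  -- A continuous surjective endomorphism pushes Haar measure to a Haar measure; `rfl` is the
  -- equality of total masses that fixes the scalar.
  exact (AddMonoidHom.mk' T hadd).measurePreserving hcont hsurj rfl

end Haar

/-! ### The action on matrices and its lift to the random variables. -/

section Smul

variable {F : Type*} [NontriviallyNormedField F] [IsUltrametricDist F]

theorem smul_def (g : GLInf (Integers F) × GLInf (Integers F)) (M : MatN F) :
    g • M = mulMat (mulMat (toMat g.1) M) (toMat g.2⁻¹) := rfl

theorem toMat_mem_Integers (g : GLInf (Integers F)) (i j : ℕ) : toMat g i j ∈ Integers F :=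
  (entry g.1 i j).2

theorem mulMat_eq_sum {F : Type*} [Field F] {A B : MatN F} {i j : ℕ} (s : Finset ℕ)
    (h : ∀ l, l ∉ s → A i l * B l j = 0) : mulMat A B i j = ∑ l ∈ s, A i l * B l j := by
  refine finsum_eq_sum_of_support_subset _ fun l hl => ?_
  by_contra hl'
  exact hl (h l (by simpa using hl'))

theorem exists_finset_row (g : GLInf (Integers F)) (i : ℕ) :
    ∃ s : Finset ℕ, ∀ l, l ∉ s → toMat g i l = 0 := by
  obtain ⟨N, hN⟩ := toMat_row g
  refine ⟨Finset.range (N + i + 1), fun l hl => ?_⟩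
  simp only [Finset.mem_range, not_lt] at hl
  exact (hN i l (by omega) (by omega)).1

theorem exists_finset_col (g : GLInf (Integers F)) (j : ℕ) :
    ∃ t : Finset ℕ, ∀ m, m ∉ t → toMat g m j = 0 := by
  obtain ⟨N, hN⟩ := toMat_row g
  refine ⟨Finset.range (N + j + 1), fun m hm => ?_⟩
  simp only [Finset.mem_range, not_lt] at hm
  exact (hN j m (by omega) (by omega)).2

variable {g : GLInf (Integers F) × GLInf (Integers F)} {i j : ℕ} {s t : Finset ℕ}

/-- The finite sets `s` and `t` depend only on `g`, `i`, `j`, so one choice serves the random matrix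
and the families X, Y, Z alike. -/
theorem smul_apply (hs : ∀ l, l ∉ s → toMat g.1 i l = 0) (ht : ∀ m, m ∉ t → toMat g.2⁻¹ m j = 0)
    (M : MatN F) :
    (g • M) i j = ∑ m ∈ t, ∑ l ∈ s, toMat g.1 i l * M l m * toMat g.2⁻¹ m j := by
  rw [smul_def, mulMat_eq_sum t fun m hm => by rw [ht m hm, mul_zero]]
  refine Finset.sum_congr rfl fun m _ => ?_
  rw [mulMat_eq_sum s fun l hl => by rw [hs l hl, zero_mul], Finset.sum_mul]

theorem smul_left_apply {a : GLInf (Integers F)} (hs : ∀ l, l ∉ s → toMat a i l = 0)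
    (M : MatN F) (j : ℕ) :
    ((a, (1 : GLInf (Integers F))) • M) i j = ∑ l ∈ s, toMat a i l * M l j := by
  rw [smul_apply (g := (a, 1)) (t := {j}) hs]
  · simp [toMat_one]
  · intro m hm
    simpa [toMat_one] using hm

theorem smul_right_apply {b : GLInf (Integers F)} (ht : ∀ m, m ∉ t → toMat b⁻¹ m j = 0)
    (M : MatN F) (i : ℕ) :
    (((1 : GLInf (Integers F)), b) • M) i j = ∑ m ∈ t, M i m * toMat b⁻¹ m j := by
  rw [smul_apply (g := (1, b)) (s := {i}) _ ht]
  · simp [toMat_one]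
  · intro m hm
    simpa [toMat_one, eq_comm] using hm

variable (g)

/-- Each entry of `g • M` is a fixed finite linear combination of entries of `M`; integrality,
additivity and continuity of the action follow. -/
theorem exists_smul_apply_eq (i j : ℕ) : ∃ (s t : Finset ℕ), ∀ M : MatN F,
    (g • M) i j = ∑ m ∈ t, ∑ l ∈ s, toMat g.1 i l * M l m * toMat g.2⁻¹ m j := by
  obtain ⟨s, hs⟩ := exists_finset_row g.1 i
  obtain ⟨t, ht⟩ := exists_finset_col g.2⁻¹ j
  exact ⟨s, t, smul_apply hs ht⟩

theorem smul_mem_Integers {M : MatN F} (hM : ∀ i j, M i j ∈ Integers F) (i j : ℕ) :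
    (g • M) i j ∈ Integers F := by
  obtain ⟨s, t, h⟩ := exists_smul_apply_eq g i j
  rw [h]
  exact sum_mem fun m _ => sum_mem fun l _ =>
    mul_mem (mul_mem (toMat_mem_Integers _ _ _) (hM _ _)) (toMat_mem_Integers _ _ _)

theorem smul_matN_add (M M' : MatN F) : g • (M + M') = g • M + g • M' := by
  funext i j
  obtain ⟨s, t, h⟩ := exists_smul_apply_eq g i j
  simp only [h, Pi.add_apply, mul_add, add_mul, Finset.sum_add_distrib]

theorem continuous_smul_apply (i j : ℕ) : Continuous fun M : MatN F => (g • M) i j := by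
  obtain ⟨s, t, h⟩ := exists_smul_apply_eq g i j
  simp only [h]
  fun_prop

/-- The action on matrices with integral entries. -/
def smulInt (M : ℕ → ℕ → Integers F) : ℕ → ℕ → Integers F := fun i j =>
  ⟨(g • (fun i j => (M i j : F) : MatN F)) i j, smul_mem_Integers g (fun i j => (M i j).2) i j⟩

theorem smulInt_add (M M' : ℕ → ℕ → Integers F) :
    smulInt g (M + M') = smulInt g M + smulInt g M' := by
  funext i j
  exact Subtype.ext (congrFun₂ (smul_matN_add g (fun i j => (M i j : F)) fun i j => (M' i j : F)) i j)

theorem continuous_smulInt : Continuous (smulInt g) := by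
  refine continuous_pi fun i => continuous_pi fun j => ?_
  refine Continuous.subtype_mk ((continuous_smul_apply g i j).comp ?_) _
  fun_prop

theorem smulInt_smulInt_inv (M : ℕ → ℕ → Integers F) : smulInt g (smulInt g⁻¹ M) = M := by
  funext i j
  apply Subtype.ext
  change (g • (g⁻¹ • (fun i j => (M i j : F) : MatN F))) i j = _
  rw [smul_inv_smul]

/-- The action of `g` transported to the random variables: it multiplies the vectors `X^{(n)}` by
`g₁`, the vectors `Y^{(n)}` by the transpose of `g₂⁻¹`, and acts on the matrix `Z`. -/
def labelMap (ω : Label → Integers F) : Label → Integers F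
  -- The vectors X^{(n)} are read as the columns of one integral matrix, and the Y^{(n)} as the rows
  -- of another, so a one-sided action moves them all at once.
  | .X n i => smulInt (g.1, 1) (fun i n => ω (.X n i)) i n
  | .Y n j => smulInt (1, g.2) (fun n j => ω (.Y n j)) n j
  | .Z i j => smulInt g (fun i j => ω (.Z i j)) i j

theorem labelMap_add (ω ω' : Label → Integers F) :
    labelMap g (ω + ω') = labelMap g ω + labelMap g ω' := by
  funext l
  cases l with
  | X n i => exact congrFun₂ (smulInt_add (g.1, 1) (fun i n => ω (.X n i)) _) i n
  | Y n j => exact congrFun₂ (smulInt_add (1, g.2) (fun n j => ω (.Y n j)) _) n j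
  | Z i j => exact congrFun₂ (smulInt_add g (fun i j => ω (.Z i j)) _) i j

theorem continuous_labelMap : Continuous (labelMap g) := by
  refine continuous_pi fun l => ?_
  cases l with
  | X n i =>
    exact (continuous_apply_apply i n).comp ((continuous_smulInt (g.1, 1)).comp (by fun_prop))
  | Y n j =>
    exact (continuous_apply_apply n j).comp ((continuous_smulInt (1, g.2)).comp (by fun_prop))
  | Z i j =>
    exact (continuous_apply_apply i j).comp ((continuous_smulInt g).comp (by fun_prop))

theorem labelMap_labelMap_inv (ω : Label → Integers F) :
    labelMap g (labelMap g⁻¹ ω) = ω := by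
  have h1 : ((g⁻¹.1, 1) : GLInf (Integers F) × GLInf (Integers F)) = (g.1, 1)⁻¹ := by simp
  have h2 : ((1, g⁻¹.2) : GLInf (Integers F) × GLInf (Integers F)) = (1, g.2)⁻¹ := by simp
  funext l
  cases l with
  | X n i =>
    have := congrFun₂ (smulInt_smulInt_inv (g.1, 1) (fun i n => ω (.X n i))) i n
    rwa [← h1] at this
  | Y n j =>
    have := congrFun₂ (smulInt_smulInt_inv (1, g.2) (fun n j => ω (.Y n j))) n j
    rwa [← h2] at this
  | Z i j => exact congrFun₂ (smulInt_smulInt_inv g (fun i j => ω (.Z i j))) i j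

/-- Bilinearity of x yᵀ handles each rank-one term, and linearity the Z part. The uniformizer
hypothesis enters only through convergence of the series, needed to exchange them with finite sums.
-/
theorem smul_randomMatrix [LocallyCompactSpace F] {ϖ : F} (hϖ : IsUniformizer ϖ) (k : Delta)
    (ω : Label → Integers F) :
    g • randomMatrix ϖ k ω = randomMatrix ϖ k (labelMap g ω) := by
  funext i j
  obtain ⟨s, hs⟩ := exists_finset_row g.1 i
  obtain ⟨t, ht⟩ := exists_finset_col g.2⁻¹ j
  have hX : ∀ n, (labelMap g ω (.X n i) : F) = ∑ l ∈ s, toMat g.1 i l * ω (.X n l) := fun n =>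
    smul_left_apply hs (fun i n => (ω (.X n i) : F)) n
  have hY : ∀ n, (labelMap g ω (.Y n j) : F) = ∑ m ∈ t, ω (.Y n m) * toMat g.2⁻¹ m j := fun n =>
    smul_right_apply ht (fun n j => (ω (.Y n j) : F)) n
  have hZ : (labelMap g ω (.Z i j) : F) =
      ∑ m ∈ t, ∑ l ∈ s, toMat g.1 i l * ω (.Z l m) * toMat g.2⁻¹ m j :=
    smul_apply hs ht (fun i j => (ω (.Z i j) : F))
  rw [smul_apply hs ht]
  simp only [randomMatrix, hX, hY, hZ, mul_add, add_mul, Finset.sum_add_distrib]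
  congr 1
  · have hsum := fun m l => summable_randomMatrix hϖ k ω l m
    simp_rw [← tsum_mul_left, ← tsum_mul_right]
    have h1 : ∀ m l, Summable fun n : {n : ℕ // k.lim < k.1 n} =>
        toMat g.1 i l * (negPow ϖ (k.1 n) * (ω (.X n l) : F) * (ω (.Y n m) : F)) *
          toMat g.2⁻¹ m j := fun m l => ((hsum m l).mul_left _).mul_right _
    rw [Finset.sum_congr rfl fun m _ => (Summable.tsum_finsetSum fun l _ => h1 m l).symm,
      ← Summable.tsum_finsetSum fun m _ => summable_sum fun l _ => h1 m l]
    refine tsum_congr fun n => ?_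
    rw [Finset.mul_sum]
    refine Finset.sum_congr rfl fun m _ => ?_
    rw [Finset.mul_sum, Finset.sum_mul]
    refine Finset.sum_congr rfl fun l _ => ?_
    ring
  · rw [Finset.mul_sum]
    refine Finset.sum_congr rfl fun m _ => ?_
    rw [Finset.mul_sum]
    refine Finset.sum_congr rfl fun l _ => ?_
    ring

end Smul

/-! ### Block permutation matrices. -/

section Permutations

variable {F : Type*} [NontriviallyNormedField F] [IsUltrametricDist F]

/-- The involution exchanging the blocks `[0, N)` and `[N, 2N)`. -/
def blockSwap (N i : ℕ) : ℕ := if i < N then i + N else if i < 2 * N then i - N else i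

theorem blockSwap_involutive (N : ℕ) : Function.Involutive (blockSwap N) := fun i => by
  unfold blockSwap
  grind

/-- The permutation matrix of `blockSwap N`. -/
def blockSwapGL (R : Type*) [Ring R] (N : ℕ) : GLInf R :=
  -- If i + j ≥ 4N, one of the indices is at least 2N and hence fixed by the swap.
  ⟨Finsupp.domLCongr (blockSwap_involutive N).toPerm, 4 * N, fun i j hij => by
    simp only [entry, Finsupp.domLCongr_single, Finsupp.single_apply,
      Function.Involutive.coe_toPerm, blockSwap]
    grind⟩

theorem toMat_blockSwapGL (N i j : ℕ) :
    toMat (blockSwapGL (Integers F) N) i j = if blockSwap N i = j then 1 else 0 := by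
  have : blockSwap N j = i ↔ blockSwap N i = j :=
    ⟨fun h => h ▸ blockSwap_involutive N j, fun h => h ▸ blockSwap_involutive N i⟩
  simp only [toMat, entry, blockSwapGL, Finsupp.domLCongr_single, Finsupp.single_apply,
    Function.Involutive.coe_toPerm, this]
  split_ifs <;> simp

theorem blockSwapGL_inv (R : Type*) [Ring R] (N : ℕ) : (blockSwapGL R N)⁻¹ = blockSwapGL R N := by
  rw [inv_eq_iff_mul_eq_one]
  refine Subtype.ext (LinearEquiv.ext fun v => ?_)
  ext i
  change v (blockSwap N (blockSwap N i)) = v i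
  rw [blockSwap_involutive N i]

theorem blockSwapGL_smul (N : ℕ) (M : MatN F) :
    (blockSwapGL (Integers F) N, blockSwapGL (Integers F) N) • M =
      fun i j => M (blockSwap N i) (blockSwap N j) := by
  funext i j
  rw [smul_apply (s := {blockSwap N i}) (t := {blockSwap N j})]
  · simp [blockSwapGL_inv, toMat_blockSwapGL, blockSwap_involutive N j]
  · intro l hl
    rw [toMat_blockSwapGL, if_neg (by simpa [eq_comm] using hl)]
  · intro m hm
    rw [blockSwapGL_inv, toMat_blockSwapGL, if_neg]
    rintro rfl
    exact hm (by simp [blockSwap_involutive N m])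

end Permutations

/-! ### Corner events, invariance of the law and independence of blocks. -/

section Ergodicity

/-- The `σ`-algebra generated by the upper left `N × N` corner. -/
abbrev cornerSigma (F : Type*) [MeasurableSpace F] (N : ℕ) : MeasurableSpace (MatN F) :=
  ⨆ p ∈ {p : ℕ × ℕ | p.1 < N ∧ p.2 < N}, MeasurableSpace.comap (fun M => M p.1 p.2) ‹_›

theorem cornerSigma_mono (F : Type*) [MeasurableSpace F] : Monotone (cornerSigma F) := by
  intro N N' h
  refine biSup_mono fun p hp => ?_
  exact ⟨hp.1.trans_le h, hp.2.trans_le h⟩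

theorem iSup_cornerSigma (F : Type*) [MeasurableSpace F] :
    (inferInstance : MeasurableSpace (MatN F)) = ⨆ N, cornerSigma F N := by
  apply le_antisymm
  · refine iSup_le fun i => ?_
    rw [MeasurableSpace.comap_le_iff_le_map]
    refine iSup_le fun j => ?_
    rw [← MeasurableSpace.comap_le_iff_le_map, MeasurableSpace.comap_comp]
    refine le_trans ?_ (le_iSup _ (i + j + 1))
    exact le_biSup (fun p : ℕ × ℕ => MeasurableSpace.comap (fun M : MatN F => M p.1 p.2) ‹_›)
      (show (i, j) ∈ {p : ℕ × ℕ | p.1 < i + j + 1 ∧ p.2 < i + j + 1} from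
        ⟨by simp only; omega, by simp only; omega⟩)
  · refine iSup_le fun N => iSup₂_le fun p _ => ?_
    rw [← measurable_iff_comap_le]
    exact (measurable_pi_apply p.2).comp (measurable_pi_apply p.1)

theorem measurable_cornerSigma {F Ω : Type*} [MeasurableSpace F] {m : MeasurableSpace Ω} {N : ℕ}
    {f : Ω → MatN F} (hf : ∀ i j, i < N → j < N → Measurable fun ω => f ω i j) :
    Measurable[m, cornerSigma F N] f := by
  rw [measurable_iff_comap_le, cornerSigma]
  simp only [MeasurableSpace.comap_iSup, MeasurableSpace.comap_comp]
  exact iSup₂_le fun p hp => (hf p.1 p.2 hp.1 hp.2).comap_le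

instance : Countable Label := by
  refine Function.Injective.countable (β := Fin 3 × ℕ × ℕ)
    (f := fun | .X n i => (0, n, i) | .Y n i => (1, n, i) | .Z i j => (2, i, j)) ?_
  rintro (⟨n, i⟩ | ⟨n, i⟩ | ⟨n, i⟩) (⟨n', i'⟩ | ⟨n', i'⟩ | ⟨n', i'⟩) h <;> simp_all

variable {F : Type*} [NontriviallyNormedField F] [IsUltrametricDist F] [LocallyCompactSpace F]
    [MeasurableSpace F] [BorelSpace F]

/-- The σ-algebra `m` is arbitrary so that the lemma also applies to the one generated by a block of
variables. -/
theorem measurable_randomMatrix_apply {m : MeasurableSpace (Label → Integers F)} (ϖ : F)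
    (k : Delta) {i j : ℕ} (hX : ∀ n, Measurable[m] fun ω => ω (.X n i))
    (hY : ∀ n, Measurable[m] fun ω => ω (.Y n j)) (hZ : Measurable[m] fun ω => ω (.Z i j)) :
    Measurable[m] fun ω => randomMatrix ϖ k ω i j := by
  have : ProperSpace F := .of_nontriviallyNormedField_of_weaklyLocallyCompactSpace F
  have hX' := fun n => measurable_subtype_coe.comp (hX n)
  have hY' := fun n => measurable_subtype_coe.comp (hY n)
  refine Measurable.add (Measurable.tsum fun n => ?_) ?_
  · exact ((hX' n).const_mul _).mul (hY' n)
  · exact (measurable_subtype_coe.comp hZ).const_mul _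

theorem measurable_randomMatrix (ϖ : F) (k : Delta) : Measurable (randomMatrix ϖ k) :=
  measurable_pi_lambda _ fun _ => measurable_pi_lambda _ fun _ =>
    measurable_randomMatrix_apply ϖ k (fun _ => measurable_pi_apply _)
      (fun _ => measurable_pi_apply _) (measurable_pi_apply _)

instance (ϖ : F) (k : Delta) : IsProbabilityMeasure (mu ϖ k) :=
  Measure.isProbabilityMeasure_map (measurable_randomMatrix ϖ k).aemeasurable

theorem measurePreserving_labelMap (g : GLInf (Integers F) × GLInf (Integers F)) :
    MeasurePreserving (labelMap g) (Measure.infinitePi fun _ : Label => haarIntegers F)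
      (Measure.infinitePi fun _ : Label => haarIntegers F) := by
  have : ProperSpace F := .of_nontriviallyNormedField_of_weaklyLocallyCompactSpace F
  have : (haarIntegers F).IsAddLeftInvariant := by unfold haarIntegers; infer_instance
  exact measurePreserving_infinitePi _ _ (labelMap_add g) (continuous_labelMap g)
    fun ω => ⟨_, labelMap_labelMap_inv g ω⟩

theorem measurePreserving_smul_mu {ϖ : F} (hϖ : IsUniformizer ϖ) (k : Delta)
    (g : GLInf (Integers F) × GLInf (Integers F)) :
    MeasurePreserving (fun M : MatN F => g • M) (mu ϖ k) (mu ϖ k) := by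
  -- Properness gives second countability, so continuous functions on `MatN F` are measurable for
  -- the product σ-algebra.
  have : ProperSpace F := .of_nontriviallyNormedField_of_weaklyLocallyCompactSpace F
  have hg : Measurable fun M : MatN F => g • M :=
    measurable_pi_lambda _ fun i => measurable_pi_lambda _ fun j =>
      (continuous_smul_apply g i j).measurable
  refine ⟨hg, ?_⟩
  have hf := measurable_randomMatrix ϖ k
  have hT := measurePreserving_labelMap g
  rw [mu, Measure.map_map hg hf]
  conv_rhs => rw [← hT.map_eq, Measure.map_map hf hT.measurable]
  congr 1
  funext ω
  exact smul_randomMatrix g hϖ k ω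

/-- The labels of the variables on which the block with indices in `I` depends. -/
def blockLabels (I : Set ℕ) : Set Label := fun
  | .X _ i => i ∈ I
  | .Y _ j => j ∈ I
  | .Z i j => i ∈ I ∧ j ∈ I

theorem disjoint_blockLabels {I J : Set ℕ} (h : Disjoint I J) :
    Disjoint (blockLabels I) (blockLabels J) := by
  rw [Set.disjoint_left] at h ⊢
  rintro (⟨n, i⟩ | ⟨n, i⟩ | ⟨i, j⟩) h1 h2
  · exact h h1 h2
  · exact h h1 h2
  · exact h h1.1 h2.1

theorem measurable_randomMatrix_apply_block (ϖ : F) (k : Delta) {I : Set ℕ} {i j : ℕ}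
    (hi : i ∈ I) (hj : j ∈ I) :
    Measurable[⨆ l ∈ blockLabels I,
      MeasurableSpace.comap (fun ω : Label → Integers F => ω l) inferInstance]
      fun ω => randomMatrix ϖ k ω i j := by
  have h : ∀ l ∈ blockLabels I, Measurable[⨆ l ∈ blockLabels I,
      MeasurableSpace.comap (fun ω : Label → Integers F => ω l) inferInstance]
      fun ω : Label → Integers F => ω l := fun l hl => by
    rw [measurable_iff_comap_le]
    exact le_biSup (fun l => MeasurableSpace.comap (fun ω : Label → Integers F => ω l)
      inferInstance) hl
  exact measurable_randomMatrix_apply ϖ k (fun n => h _ hi) (fun n => h _ hj) (h _ ⟨hi, hj⟩)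

/-- Disjoint diagonal blocks of the random matrix are independent. -/
theorem mu_inter_blockSwap {ϖ : F} (hϖ : IsUniformizer ϖ) (k : Delta) (N : ℕ) {B : Set (MatN F)}
    (hB : MeasurableSet[cornerSigma F N] B) :
    mu ϖ k (B ∩ (fun M => (blockSwapGL (Integers F) N, blockSwapGL (Integers F) N) • M) ⁻¹' B) =
      mu ϖ k B * mu ϖ k B := by
  set τ := fun M : MatN F => (blockSwapGL (Integers F) N, blockSwapGL (Integers F) N) • M with hτ
  have hpres : MeasurePreserving τ (mu ϖ k) (mu ϖ k) := measurePreserving_smul_mu hϖ k _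
  have hBm : MeasurableSet B := by
    have := iSup_cornerSigma F ▸ le_iSup (cornerSigma F) N
    exact this B hB
  have hf := measurable_randomMatrix ϖ k
  set m : Label → MeasurableSpace (Label → Integers F) := fun l =>
    MeasurableSpace.comap (fun ω => ω l) inferInstance
  have hind : ProbabilityTheory.Indep (⨆ l ∈ blockLabels {i | i < N}, m l)
      (⨆ l ∈ blockLabels {i | N ≤ i}, m l)
      (Measure.infinitePi fun _ : Label => haarIntegers F) := by
    refine ProbabilityTheory.indep_iSup_of_disjoint
      (fun l => (measurable_pi_apply l).comap_le) ?_ (disjoint_blockLabels ?_)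
    · exact ProbabilityTheory.iIndepFun_infinitePi (P := fun _ : Label => haarIntegers F)
        (X := fun _ x => x) fun _ => measurable_id
    · exact Set.disjoint_left.mpr fun i (h : i < N) (h' : N ≤ i) => absurd h (not_lt.mpr h')
  have h1 : MeasurableSet[⨆ l ∈ blockLabels {i | i < N}, m l] (randomMatrix ϖ k ⁻¹' B) :=
    measurable_cornerSigma
      (fun i j hi hj => measurable_randomMatrix_apply_block ϖ k (I := {i | i < N}) hi hj) hB
  have h2 : MeasurableSet[⨆ l ∈ blockLabels {i | N ≤ i}, m l]
      ((fun ω => τ (randomMatrix ϖ k ω)) ⁻¹' B) := by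
    -- For i < N the swap reads index i + N, so the moved corner uses only labels with indices at
    -- least N.
    refine measurable_cornerSigma (fun i j hi hj => ?_) hB
    simp only [hτ, blockSwapGL_smul]
    refine measurable_randomMatrix_apply_block ϖ k (I := {i | N ≤ i}) ?_ ?_ <;>
      simp [blockSwap, hi, hj]
  have h3 := (ProbabilityTheory.Indep_iff _ _ _).mp hind _ _ h1 h2
  have hB2 : mu ϖ k B = mu ϖ k (τ ⁻¹' B) :=
    (hpres.measure_preimage hBm.nullMeasurableSet).symm
  -- By invariance one factor becomes the measure of the moved event, which puts the claim in the
  -- form given by independence.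
  have hB3 : mu ϖ k B * mu ϖ k B = mu ϖ k B * mu ϖ k (τ ⁻¹' B) := by rw [← hB2]
  rw [hB3, mu, Measure.map_apply hf (hBm.inter (hpres.measurable hBm)), Measure.map_apply hf hBm,
    Measure.map_apply hf (hpres.measurable hBm)]
  exact h3

end Ergodicity

end InfMat

end

theorem theorem3p4 (F : Type*) [NontriviallyNormedField F] [IsUltrametricDist F]
    [LocallyCompactSpace F] [MeasurableSpace F] [BorelSpace F]
    (ϖ : F) (hϖ : InfMat.IsUniformizer ϖ) (k : InfMat.Delta) :
    InfMat.IsErgodicInvariant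
      (InfMat.GLInf (InfMat.Integers F) × InfMat.GLInf (InfMat.Integers F))
      (InfMat.mu ϖ k) where
  isProbabilityMeasure := inferInstance
  invariant := ⟨fun g _ hs =>
    (InfMat.measurePreserving_smul_mu hϖ k g).measure_preimage hs.nullMeasurableSet⟩
  ergodic _ hA hinv :=
    InfMat.measure_eq_zero_or_compl_of_decoupling (InfMat.cornerSigma_mono F)
      (InfMat.iSup_cornerSigma F) (fun _ => InfMat.measurePreserving_smul_mu hϖ k _)
      (fun N _ hB => InfMat.mu_inter_blockSwap hϖ k N hB) hA fun _ => hinv _
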